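/- Let $A\in\mathbb R^{n\times n}$ be symmetric positive semidefinite. For $x\in\{-1,1\}^n$ let $\mathrm{IQP}_A(x)=x^{\mathsf T}Ax$, and consider the relaxation $\max\{\operatorname{tr}(AS): S\succeq 0,\ S_{ii}=1 \text{ for all } i\}$. For $X\in\mathbb R^{n\times k}$ consider the system, in an unknown symmetric $Y\in\mathbb R^{k\times k}$, $$Y\succeq 0,\qquad \operatorname{tr}(X^{\mathsf T}AX\,Y)=0,\qquad Y\neq 0. \qquad(\ast)$$ 1. (One step.) Suppose $k>\operatorname{rank}(A)$ and every row of $X$ has Euclidean norm at most $1$; put $S=XX^{\mathsf T}$. Then $(\ast)$ is feasible, and every solution can be multiplied by a positive scalar to give a solution whose largest eigenvalue is $1$. For every solution $Y$ with largest eigenvalue $1$, the matrix $S'=X(I_k-Y)X^{\mathsf T}$ satisfies $S'\succeq 0$, $\operatorname{rank}(S')<k$, $\operatorname{tr}(AS')=\operatorname{tr}(AS)$ and $S'_{ii}\in[0,1]$ for all $i$. For some such $Y$, moreover, $\operatorname{rank}(S')\le\operatorname{rank}(A)$. 2. (Rank reduction.) Starting from a matrix $S\succeq0$ with $S_{ii}\le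 1$ for all $i$, repeat the following as long as $\operatorname{rank}(S)>\operatorname{rank}(A)$: factor $S=XX^{\mathsf T}$ with $X\in\mathbb R^{n\times\operatorname{rank}(S)}$, choose any solution $Y$ of $(\ast)$ with largest eigenvalue $1$, and replace $S$ by $X(I-Y)X^{\mathsf T}$. Every step strictly decreases the rank, an output exists, and every output $S'$ satisfies $S'\succeq0$, $\operatorname{rank}(S')\le\operatorname{rank}(A)$, $\operatorname{tr}(AS')=\operatorname{tr}(AS)$ and $S'_{ii}\in[0,1]$ for all $i$. 3. (Approximation ratio.) For integers $r\ge1$ let $$\rho(r)=\frac{2}{\pi\gamma(r)},\qquad \gamma(r)=\frac2r\left(\frac{\Gamma((r+1)/2)}{\Gamma(r/2)}\right)^2 .$$ Then $\rho(r)=\frac2\pi+\Theta(1/r)$: there are absolute constants $c,C>0$ with $\frac2\pi+\frac cr\le\rho(r)\le\frac2\pi+\frac Cr$ for all $r\ge1$. Suppose $A\ne0$, let $S^*$ be an optimal solution of the relaxation and $S'$ any output of the procedure in 2 started at $S^*$. Then $S'$ maximizes $\operatorname{tr}(AT)$ over all $T\succeq0$ with $T_{ii}\le1$ for all $i$, and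 $\operatorname{tr}(AS^*)>0$. Moreover, for every factorization $S'=XX^{\mathsf T}$ with $X\in\mathbb R^{n\times m}$, $m\le\operatorname{rank}(A)$, if $g$ is uniformly distributed on the unit sphere of $\mathbb R^m$ and $\hat x=\operatorname{sgn}(Xg)\in\{-1,1\}^n$ (entrywise, with $\operatorname{sgn}(0)=1$), then $$\frac{\mathbb E_g[\mathrm{IQP}_A(\hat x)]}{\operatorname{tr}(AS^*)}\ \ge\ \rho(\operatorname{rank}(A)),\qquad \mathbb E_g[\mathrm{IQP}_A(\hat x)]\ \ge\ \rho(\operatorname{rank}(A))\max_{x\in\{-1,1\}^n}\mathrm{IQP}_A(x).$$ In particular, randomized rounding has a guaranteed approximation ratio of $\frac2\pi+\Theta(1/\operatorname{rank}(A))$, a constant improvement over $\frac2\pi$ when $\operatorname{rank}(A)$ is constant. -/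

import Mathlib

open MeasureTheory Matrix

noncomputable section

namespace PSDGrothendieck

/-- The quadratic objective `xᵀ A x` of the integer problem. -/
def iqp {n : ℕ} (A : Matrix (Fin n) (Fin n) ℝ) (x : Fin n → ℝ) : ℝ :=
  x ⬝ᵥ (A *ᵥ x)

/-- The objective `tr (A S)` of the semidefinite relaxation. -/
def sdp {n : ℕ} (A S : Matrix (Fin n) (Fin n) ℝ) : ℝ :=
  (A * S).trace

/-- Feasible points of the semidefinite relaxation: `S ⪰ 0` and `S_ii = 1`. -/
def Feasible {n : ℕ} (S : Matrix (Fin n) (Fin n) ℝ) : Prop :=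
  S.PosSemidef ∧ ∀ i, S i i = 1

/-- Optimal solutions of the semidefinite relaxation. -/
def Optimal {n : ℕ} (A S : Matrix (Fin n) (Fin n) ℝ) : Prop :=
  Feasible S ∧ ∀ T : Matrix (Fin n) (Fin n) ℝ, Feasible T → sdp A T ≤ sdp A S

/-- Feasibility with the diagonal constraint relaxed to `S_ii ≤ 1`. -/
def WeaklyFeasible {n : ℕ} (S : Matrix (Fin n) (Fin n) ℝ) : Prop :=
  S.PosSemidef ∧ ∀ i, S i i ≤ 1

/-- The modified system `Y ⪰ 0`, `tr (Xᵀ A X Y) = 0`, `Y ≠ 0` in the unknown `Y`. -/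
def ModifiedSystem {n k : ℕ} (A : Matrix (Fin n) (Fin n) ℝ) (X : Matrix (Fin n) (Fin k) ℝ)
    (Y : Matrix (Fin k) (Fin k) ℝ) : Prop :=
  Y.PosSemidef ∧ (Xᵀ * A * X * Y).trace = 0 ∧ Y ≠ 0

/-- The largest (real) eigenvalue of `Y` is `1`. -/
def MaxEigOne {k : ℕ} (Y : Matrix (Fin k) (Fin k) ℝ) : Prop :=
  IsGreatest (spectrum ℝ Y) 1

/-- The update `S' = X U Xᵀ` with `U = I - Y`. -/
def update {n k : ℕ} (X : Matrix (Fin n) (Fin k) ℝ) (Y : Matrix (Fin k) (Fin k) ℝ) :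
    Matrix (Fin n) (Fin n) ℝ :=
  X * (1 - Y) * Xᵀ

/-- One step of the modified rank reduction, performed while `rank S > rank A`: factor
`S = X Xᵀ` with `rank S` columns, take any solution `Y` of the modified system scaled so that
its largest eigenvalue is `1`, and replace `S` by `X (I - Y) Xᵀ`. -/
def Step {n : ℕ} (A S S' : Matrix (Fin n) (Fin n) ℝ) : Prop :=
  A.rank < S.rank ∧
    ∃ (X : Matrix (Fin n) (Fin S.rank) ℝ) (Y : Matrix (Fin S.rank) (Fin S.rank) ℝ),
      S = X * Xᵀ ∧ ModifiedSystem A X Y ∧ MaxEigOne Y ∧ S' = update X Y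

/-- `S'` is an output of the modified rank reduction started at `S`: it is reached by finitely
many steps, and no further step is possible. -/
def Output {n : ℕ} (A S S' : Matrix (Fin n) (Fin n) ℝ) : Prop :=
  Relation.ReflTransGen (Step A) S S' ∧ ∀ S'', ¬ Step A S' S''

/-- The sign, with values in `{-1, 1}`. -/
def sgn (t : ℝ) : ℝ := if 0 ≤ t then 1 else -1

/-- The uniform probability distribution on the unit sphere of `ℝ^k` (for `k ≥ 1`). -/
def uniformSphere (k : ℕ) : Measure (Metric.sphere (0 : EuclideanSpace ℝ (Fin k)) 1) :=
  ((volume : Measure (EuclideanSpace ℝ (Fin k))).toSphere Set.univ)⁻¹ •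
    (volume : Measure (EuclideanSpace ℝ (Fin k))).toSphere

/-- The rounded point `sgn (X g)`. -/
def rounded {n k : ℕ} (X : Matrix (Fin n) (Fin k) ℝ) (g : EuclideanSpace ℝ (Fin k)) :
    Fin n → ℝ :=
  fun i => sgn ((X *ᵥ g.ofLp) i)

/-- The expected objective value `E_g [IQP_A (sgn (X g))]` of randomized rounding. -/
def expectedValue {n k : ℕ} (A : Matrix (Fin n) (Fin n) ℝ) (X : Matrix (Fin n) (Fin k) ℝ) : ℝ :=
  ∫ g, iqp A (rounded X (g : EuclideanSpace ℝ (Fin k))) ∂(uniformSphere k)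

/-- `γ(k) = (2 / k) (Γ((k + 1) / 2) / Γ(k / 2))²`. -/
def gammaConst (k : ℕ) : ℝ :=
  2 / (k : ℝ) * (Real.Gamma (((k : ℝ) + 1) / 2) / Real.Gamma ((k : ℝ) / 2)) ^ 2

/-- The guaranteed approximation ratio `2 / (π γ(k))`. -/
def ratio (k : ℕ) : ℝ := 2 / (Real.pi * gammaConst k)

end PSDGrothendieck

end

/-!
A single reduction step works because `Xᵀ A X` is positive semidefinite of rank at most `rank A`,
hence singular when `k > rank A`: the orthogonal projection `Y` onto its kernel solves the modified
system and leaves `rank (I - Y) ≤ rank A` (`exists_kernel_projection`). For any solution with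
largest eigenvalue `1`, the matrix `I - Y` is positive semidefinite and singular, which lowers the
rank, shrinks the diagonal of `X Xᵀ`, and keeps the objective since `tr (Xᵀ A X Y) = 0`. Since every
positive semidefinite matrix factors through its rank (`exists_factorization`), the reduction can
stop only at rank at most `rank A`, and it terminates because the rank drops.

Slack on the diagonal can be filled up without lowering the objective, so an optimal solution of the
relaxation, and with it every output `S' = X Xᵀ`, is optimal among all weakly feasible matrices.

For the rounding guarantee the expectation of `xᵀ A x ≥ 0` at `x = sgn (X g) - c X g` is expanded.
The mixed terms involve `E [sgn (u · g) (v · g)] = κ u · v` for unit vectors `u`, with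
`κ = E |g₁|`, and the quadratic ones `E [(u · g) (v · g)] = u · v / m`; both moments follow from
Gaussian integrals in polar coordinates (`sphere_integral_comp_inner_mul_inner`). The result
(`le_expectedValue`) contains `tr (A V Xᵀ)`, where `V` has the normalized rows of `X`. The rows of
`X` may be shorter than `1`, but first-order optimality of `X Xᵀ` gives
`tr (A V Xᵀ) = tr (A X Xᵀ)` (`sdp_normalizedRows`). The choice `c = m κ` then yields the factor
`m κ² = 2 / (π γ(m))`.

The factorization may have fewer than `rank A` columns, so `γ` has to be nondecreasing. From
`γ(k) γ(k + 1) = k / (k + 1)` this is equivalent to `γ(k)² ≤ k / (k + 1)` (`gammaConst_sq_le`), which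
also gives the lower bound in `2 / (π γ(k)) = 2 / π + Θ(1 / k)`; the upper bound comes from
`γ(k) ≥ k / (k + 1)`.
-/

namespace PSDGrothendieck

/-! ### Spectral facts about positive semidefinite matrices -/

theorem trace_mul_nonneg {n : ℕ} {A B : Matrix (Fin n) (Fin n) ℝ}
    (hA : A.PosSemidef) (hB : B.PosSemidef) : 0 ≤ (A * B).trace := by
  obtain ⟨C, rfl⟩ : ∃ C : Matrix (Fin n) (Fin n) ℝ, B = C * Cᴴ := by
    open scoped MatrixOrder in
    obtain ⟨C, hC⟩ := CStarAlgebra.nonneg_iff_eq_mul_star_self.mp hB.nonneg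
    exact ⟨C, hC⟩
  rw [← Matrix.mul_assoc, Matrix.trace_mul_comm, ← Matrix.mul_assoc]
  exact (hA.conjTranspose_mul_mul_same C).trace_nonneg

theorem exists_orthogonal_diagonalization {k : ℕ} {M : Matrix (Fin k) (Fin k) ℝ}
    (hM : M.IsHermitian) :
    ∃ U : Matrix (Fin k) (Fin k) ℝ, U * Uᵀ = 1 ∧ Uᵀ * U = 1 ∧
      M = U * diagonal hM.eigenvalues * Uᵀ := by
  refine ⟨hM.eigenvectorUnitary, ?_, ?_, ?_⟩
  · simpa [star_eq_conjTranspose] using Unitary.coe_mul_star_self hM.eigenvectorUnitary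
  · simpa [star_eq_conjTranspose] using Unitary.coe_star_mul_self hM.eigenvectorUnitary
  · have h := hM.spectral_theorem
    rw [Unitary.conjStarAlgAut_apply] at h
    simpa [star_eq_conjTranspose, Function.comp_def] using h

/-- A positive semidefinite matrix factors through its rank: keep the eigenvectors with nonzero
eigenvalue, each scaled by the square root of that eigenvalue. -/
theorem exists_factorization {n : ℕ} {S : Matrix (Fin n) (Fin n) ℝ} (hS : S.PosSemidef) :
    ∃ X : Matrix (Fin n) (Fin S.rank) ℝ, S = X * Xᵀ := by
  classical
  obtain ⟨U, -, -, h⟩ := exists_orthogonal_diagonalization hS.1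
  have hcard : Fintype.card {i // hS.1.eigenvalues i ≠ 0} = Fintype.card (Fin S.rank) := by
    rw [← hS.1.rank_eq_card_non_zero_eigs, Fintype.card_fin]
  let e := Fintype.equivOfCardEq hcard
  refine ⟨Matrix.of fun i j => U i (e.symm j) * √(hS.1.eigenvalues (e.symm j)), ?_⟩
  conv_lhs => rw [h]
  ext i j
  rw [Matrix.mul_apply]
  simp only [Matrix.mul_diagonal]
  simp only [Matrix.mul_apply, Matrix.transpose_apply, Matrix.of_apply]
  rw [e.symm.sum_comp (fun l : {i // hS.1.eigenvalues i ≠ 0} =>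
      U i l * √(hS.1.eigenvalues l) * (U j l * √(hS.1.eigenvalues l)))]
  have hterm : ∀ l, U i l * √(hS.1.eigenvalues l) * (U j l * √(hS.1.eigenvalues l)) =
      U i l * hS.1.eigenvalues l * U j l := fun l => by
    linear_combination U i l * U j l * Real.mul_self_sqrt (hS.eigenvalues_nonneg l)
  simp only [hterm]
  rw [← Finset.sum_subtype (Finset.univ.filter fun l => hS.1.eigenvalues l ≠ 0) (by simp)
    (fun l => U i l * hS.1.eigenvalues l * U j l), Finset.sum_filter]
  refine Finset.sum_congr rfl fun l _ => ?_
  split_ifs with h0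
  · rfl
  · simp [not_not.1 h0]

open scoped Pointwise in
theorem maxEigOne_iff {k : ℕ} {Y : Matrix (Fin k) (Fin k) ℝ} (hY : Y.IsHermitian) :
    MaxEigOne Y ↔ ¬ IsUnit (1 - Y) ∧ (1 - Y).PosSemidef := by
  have h1 : (1 : ℝ) ∈ spectrum ℝ Y ↔ ¬ IsUnit (1 - Y) := by
    rw [spectrum.mem_iff, map_one]
  have h2 : (1 : ℝ) ∈ upperBounds (spectrum ℝ Y) ↔ (1 - Y).PosSemidef := by
    rw [posSemidef_iff_isHermitian_and_spectrum_nonneg]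
    have h3 : spectrum ℝ (1 - Y) = ({1} : Set ℝ) - spectrum ℝ Y := by
      rw [spectrum.singleton_sub_eq, map_one]
    rw [h3]
    constructor
    · intro h
      refine ⟨Matrix.isHermitian_one.sub hY, ?_⟩
      rintro x hx
      simp only [Set.singleton_sub, Set.mem_image] at hx
      obtain ⟨y, hy, rfl⟩ := hx
      have := h hy
      simp only [Set.mem_ofPred_eq]
      linarith
    · rintro ⟨-, h⟩ y hy
      have : (1 - y) ∈ ({1} : Set ℝ) - spectrum ℝ Y := by
        simp only [Set.singleton_sub, Set.mem_image]
        exact ⟨y, hy, rfl⟩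
      have := h this
      simp only [Set.mem_ofPred_eq] at this
      linarith
  rw [MaxEigOne, IsGreatest, h1, h2]

theorem exists_smul_maxEigOne {k : ℕ} {Y : Matrix (Fin k) (Fin k) ℝ} (hY : Y.PosSemidef)
    (hne : Y ≠ 0) : ∃ a : ℝ, 0 < a ∧ MaxEigOne (a • Y) := by
  have hk : Nonempty (Fin k) := by
    by_contra h
    rw [not_nonempty_iff] at h
    exact hne (Subsingleton.elim _ _)
  obtain ⟨i, hi⟩ := Finite.exists_max hY.1.eigenvalues
  have hpos : 0 < hY.1.eigenvalues i := by
    refine lt_of_le_of_ne (hY.eigenvalues_nonneg i) fun h0 => hne ?_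
    rw [← hY.1.eigenvalues_eq_zero_iff]
    ext j
    exact le_antisymm ((hi j).trans h0.symm.le) (hY.eigenvalues_nonneg j)
  refine ⟨(hY.1.eigenvalues i)⁻¹, inv_pos.2 hpos, ?_⟩
  have hs : spectrum ℝ Y = Set.range hY.1.eigenvalues := hY.1.spectrum_real_eq_range_eigenvalues
  rw [MaxEigOne, spectrum.smul_eq_smul _ _ (by rw [hs]; exact Set.range_nonempty _), hs]
  constructor
  · exact ⟨_, ⟨i, rfl⟩, by simp [hpos.ne']⟩
  · rintro _ ⟨_, ⟨j, rfl⟩, rfl⟩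
    simp only [smul_eq_mul]
    rw [inv_mul_le_iff₀ hpos, mul_one]
    exact hi j

theorem rank_lt_of_not_isUnit {k : ℕ} {M : Matrix (Fin k) (Fin k) ℝ} (h : ¬ IsUnit M) :
    M.rank < k := by
  refine lt_of_le_of_ne M.rank_le_width fun hr => h ?_
  rw [← mulVec_surjective_iff_isUnit]
  have : LinearMap.range M.mulVecLin = ⊤ := by
    apply Submodule.eq_top_of_finrank_eq
    rw [Module.finrank_fin_fun]
    exact hr
  exact LinearMap.range_eq_top.1 this

/-- The orthogonal projection onto the kernel of a singular symmetric matrix has largest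
eigenvalue `1`, is annihilated by the matrix, and its complement has the same rank as the
matrix. -/
theorem exists_kernel_projection {k : ℕ} {M : Matrix (Fin k) (Fin k) ℝ} (hM : M.IsHermitian)
    (hr : M.rank < k) :
    ∃ Y : Matrix (Fin k) (Fin k) ℝ, Y.PosSemidef ∧ M * Y = 0 ∧ MaxEigOne Y ∧
      (1 - Y).rank ≤ M.rank := by
  classical
  obtain ⟨U, hU1, hU2, h⟩ := exists_orthogonal_diagonalization hM
  set d := hM.eigenvalues with hd
  let e : Fin k → ℝ := fun i => if d i = 0 then 1 else 0
  have hconj : ∀ f : Fin k → ℝ, 0 ≤ f → (U * diagonal f * Uᵀ).PosSemidef := fun f hf => by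
    simpa using (PosSemidef.diagonal hf).mul_mul_conjTranspose_same U
  have hsub : 1 - U * diagonal e * Uᵀ = U * diagonal (1 - e) * Uᵀ := by
    rw [show diagonal (1 - e) = 1 - diagonal e by rw [← diagonal_one, diagonal_sub]; rfl,
      Matrix.mul_sub, Matrix.sub_mul, Matrix.mul_one, hU1]
  have hrank : (1 - U * diagonal e * Uᵀ).rank ≤ M.rank := by
    rw [hsub, hM.rank_eq_rank_diagonal]
    refine ((rank_mul_le_left _ _).trans (rank_mul_le_right _ _)).trans ?_
    rw [rank_diagonal, rank_diagonal]
    refine Fintype.card_le_of_embedding (Subtype.impEmbedding _ _ fun i hi => ?_)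
    intro h0
    apply hi
    have : d i = 0 := h0
    simp [e, this]
  have hY : (U * diagonal e * Uᵀ).PosSemidef :=
    hconj e fun i => by simp only [e, Pi.zero_apply]; split_ifs <;> norm_num
  refine ⟨U * diagonal e * Uᵀ, hY, ?_, (maxEigOne_iff hY.1).2 ⟨fun hu => ?_, ?_⟩, hrank⟩
  · have : diagonal d * diagonal e = 0 := by
      rw [diagonal_mul_diagonal]
      ext i j
      simp only [diagonal_apply, e]
      split_ifs <;> simp_all
    calc M * (U * diagonal e * Uᵀ) = U * (diagonal d * (Uᵀ * U) * diagonal e) * Uᵀ := by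
          rw [h]; simp only [Matrix.mul_assoc]
      _ = 0 := by rw [hU2, Matrix.mul_one, this]; simp
  · have := rank_of_isUnit _ hu
    rw [Fintype.card_fin] at this
    omega
  · rw [hsub]
    refine hconj _ fun i => ?_
    simp only [e, Pi.zero_apply, Pi.sub_apply, Pi.one_apply]
    split_ifs <;> norm_num

/-! ### The rank reduction -/

theorem posSemidef_mul_transpose {n k : ℕ} (X : Matrix (Fin n) (Fin k) ℝ) :
    (X * Xᵀ).PosSemidef := by
  simpa using posSemidef_self_mul_conjTranspose X

theorem isHermitian_gram {n k : ℕ} {A : Matrix (Fin n) (Fin n) ℝ} (hA : A.PosSemidef)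
    (X : Matrix (Fin n) (Fin k) ℝ) : (Xᵀ * A * X).IsHermitian := by
  simpa using (hA.conjTranspose_mul_mul_same X).1

theorem update_eq {n k : ℕ} (X : Matrix (Fin n) (Fin k) ℝ) (Y : Matrix (Fin k) (Fin k) ℝ) :
    update X Y = X * Xᵀ - X * Y * Xᵀ := by
  rw [update, Matrix.mul_sub, Matrix.sub_mul, Matrix.mul_one]

theorem exists_modifiedSystem_rank_le {n k : ℕ} {A : Matrix (Fin n) (Fin n) ℝ}
    (hA : A.PosSemidef) (X : Matrix (Fin n) (Fin k) ℝ) (hk : A.rank < k) :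
    ∃ Y, ModifiedSystem A X Y ∧ MaxEigOne Y ∧ (update X Y).rank ≤ A.rank := by
  have hle : (Xᵀ * A * X).rank ≤ A.rank :=
    (rank_mul_le_left _ _).trans (rank_mul_le_right _ _)
  obtain ⟨Y, hY, h0, h1, hr⟩ := exists_kernel_projection (isHermitian_gram hA X) (hle.trans_lt hk)
  refine ⟨Y, ⟨hY, by rw [h0, trace_zero], ?_⟩, h1, ?_⟩
  · rintro rfl
    exact ((maxEigOne_iff hY.1).1 h1).1 (by simp)
  · exact ((rank_mul_le_left _ _).trans (rank_mul_le_right _ _)).trans (hr.trans hle)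

theorem ModifiedSystem.exists_smul {n k : ℕ} {A : Matrix (Fin n) (Fin n) ℝ}
    {X : Matrix (Fin n) (Fin k) ℝ} {Y : Matrix (Fin k) (Fin k) ℝ} (h : ModifiedSystem A X Y) :
    ∃ a : ℝ, 0 < a ∧ ModifiedSystem A X (a • Y) ∧ MaxEigOne (a • Y) := by
  obtain ⟨a, ha, hm⟩ := exists_smul_maxEigOne h.1 h.2.2
  refine ⟨a, ha, ⟨h.1.smul ha.le, ?_, smul_ne_zero ha.ne' h.2.2⟩, hm⟩
  rw [Matrix.mul_smul, trace_smul, h.2.1, smul_zero]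

theorem update_posSemidef {n k : ℕ} (X : Matrix (Fin n) (Fin k) ℝ)
    {Y : Matrix (Fin k) (Fin k) ℝ} (hY : Y.PosSemidef) (h1 : MaxEigOne Y) :
    (update X Y).PosSemidef := by
  simpa [update] using ((maxEigOne_iff hY.1).1 h1).2.mul_mul_conjTranspose_same X

theorem rank_update_lt {n k : ℕ} (X : Matrix (Fin n) (Fin k) ℝ)
    {Y : Matrix (Fin k) (Fin k) ℝ} (hY : Y.PosSemidef) (h1 : MaxEigOne Y) :
    (update X Y).rank < k :=
  ((rank_mul_le_left _ _).trans (rank_mul_le_right _ _)).trans_lt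
    (rank_lt_of_not_isUnit ((maxEigOne_iff hY.1).1 h1).1)

theorem sdp_update {n k : ℕ} {A : Matrix (Fin n) (Fin n) ℝ}
    {X : Matrix (Fin n) (Fin k) ℝ} {Y : Matrix (Fin k) (Fin k) ℝ} (h : ModifiedSystem A X Y) :
    sdp A (update X Y) = sdp A (X * Xᵀ) := by
  have h0 : (A * (X * Y * Xᵀ)).trace = 0 := by
    rw [← Matrix.mul_assoc, Matrix.trace_mul_comm, ← h.2.1]
    simp only [Matrix.mul_assoc]
  rw [sdp, update_eq, Matrix.mul_sub, trace_sub, h0, sub_zero, sdp]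

theorem update_diag_le {n k : ℕ} (X : Matrix (Fin n) (Fin k) ℝ)
    {Y : Matrix (Fin k) (Fin k) ℝ} (hY : Y.PosSemidef) (i : Fin n) :
    update X Y i i ≤ (X * Xᵀ) i i := by
  have h : (X * Y * Xᵀ).PosSemidef := by simpa using hY.mul_mul_conjTranspose_same X
  rw [update_eq, Matrix.sub_apply]
  linarith [h.diag_nonneg (i := i)]

theorem Step.rank_lt {n : ℕ} {A S S' : Matrix (Fin n) (Fin n) ℝ} (h : Step A S S') :
    S'.rank < S.rank := by
  obtain ⟨-, X, Y, -, hY, h1, rfl⟩ := h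
  exact rank_update_lt X hY.1 h1

theorem Step.weaklyFeasible {n : ℕ} {A S S' : Matrix (Fin n) (Fin n) ℝ} (h : Step A S S')
    (hS : WeaklyFeasible S) : WeaklyFeasible S' := by
  obtain ⟨-, X, Y, hX, hY, h1, rfl⟩ := h
  refine ⟨update_posSemidef X hY.1 h1, fun i => (update_diag_le X hY.1 i).trans ?_⟩
  rw [← hX]
  exact hS.2 i

theorem Step.sdp_eq {n : ℕ} {A S S' : Matrix (Fin n) (Fin n) ℝ} (h : Step A S S') :
    sdp A S' = sdp A S := by
  obtain ⟨-, X, Y, hX, hY, h1, rfl⟩ := h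
  rw [sdp_update hY, ← hX]

theorem exists_step {n : ℕ} {A S : Matrix (Fin n) (Fin n) ℝ} (hA : A.PosSemidef)
    (hS : S.PosSemidef) (hr : A.rank < S.rank) : ∃ S', Step A S S' := by
  obtain ⟨X, hX⟩ := exists_factorization hS
  obtain ⟨Y, hY, h1, -⟩ := exists_modifiedSystem_rank_le hA X hr
  exact ⟨_, hr, X, Y, hX, hY, h1, rfl⟩

theorem exists_output {n : ℕ} (A S : Matrix (Fin n) (Fin n) ℝ) : ∃ S', Output A S S' := by
  induction hr : S.rank using Nat.strong_induction_on generalizing S with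
  | _ r ih =>
    by_cases h : ∃ T, Step A S T
    · obtain ⟨T, hT⟩ := h
      obtain ⟨S', h1, h2⟩ := ih _ (hr ▸ hT.rank_lt) T rfl
      exact ⟨S', .head hT h1, h2⟩
    · exact ⟨S, .refl, not_exists.1 h⟩

theorem Output.invariant {n : ℕ} {A S S' : Matrix (Fin n) (Fin n) ℝ} (h : Output A S S')
    (hS : WeaklyFeasible S) : WeaklyFeasible S' ∧ sdp A S' = sdp A S := by
  refine Relation.ReflTransGen.rec (motive := fun T _ => WeaklyFeasible T ∧ sdp A T = sdp A S)
    ⟨hS, rfl⟩ (fun _ hT ih => ⟨hT.weaklyFeasible ih.1, hT.sdp_eq.trans ih.2⟩) h.1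

theorem Output.rank_le {n : ℕ} {A S S' : Matrix (Fin n) (Fin n) ℝ} (h : Output A S S')
    (hA : A.PosSemidef) (hS : WeaklyFeasible S) : S'.rank ≤ A.rank := by
  by_contra! hr
  obtain ⟨T, hT⟩ := exists_step hA (h.invariant hS).1.1 hr
  exact h.2 T hT

/-! ### Optimality among weakly feasible matrices -/

theorem Optimal.sdp_le {n : ℕ} {A S : Matrix (Fin n) (Fin n) ℝ} (hA : A.PosSemidef)
    (hS : Optimal A S) {T : Matrix (Fin n) (Fin n) ℝ} (hT : WeaklyFeasible T) :
    sdp A T ≤ sdp A S := by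
  have hD : (diagonal fun i => 1 - T i i).PosSemidef :=
    PosSemidef.diagonal fun i => sub_nonneg.2 (hT.2 i)
  have h := hS.2 (T + diagonal fun i => 1 - T i i)
    ⟨hT.1.add hD, fun i => by simp⟩
  have h2 := trace_mul_nonneg hA hD
  rw [sdp, Matrix.mul_add, trace_add] at h
  rw [sdp]
  linarith

theorem Optimal.sdp_pos {n : ℕ} {A S : Matrix (Fin n) (Fin n) ℝ} (hA : A.PosSemidef)
    (hA0 : A ≠ 0) (hS : Optimal A S) : 0 < sdp A S := by
  refine lt_of_lt_of_le ?_ (hS.2 1 ⟨PosSemidef.one, fun i => by simp⟩)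
  rw [sdp, Matrix.mul_one]
  exact lt_of_le_of_ne hA.trace_nonneg fun h => hA0 (hA.trace_eq_zero_iff.1 h.symm)

theorem Optimal.iqp_le {n : ℕ} {A S : Matrix (Fin n) (Fin n) ℝ} (hS : Optimal A S)
    {x : Fin n → ℝ} (hx : ∀ i, x i = 1 ∨ x i = -1) : iqp A x ≤ sdp A S := by
  have h := hS.2 (vecMulVec x x) ⟨by simpa using posSemidef_vecMulVec_self_star x, fun i => by
    rcases hx i with h | h <;> simp [vecMulVec_apply, h]⟩
  rwa [sdp, mul_vecMulVec, trace_vecMulVec, dotProduct_comm] at h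

open scoped RealInnerProductSpace

/-! ### Moments of the uniform distribution on the sphere -/

theorem integral_pow_mul_exp_neg_sq (q : ℕ) :
    ∫ t in Set.Ioi (0 : ℝ), t ^ q * Real.exp (-t ^ 2) = Real.Gamma (((q : ℝ) + 1) / 2) / 2 := by
  have h := integral_rpow_mul_exp_neg_rpow (p := 2) (q := q) two_pos
    (by linarith [Nat.cast_nonneg (α := ℝ) q])
  simp only [Real.rpow_natCast, Real.rpow_ofNat] at h
  rw [h]
  ring

theorem integral_abs_mul_exp_neg_sq : ∫ t : ℝ, |t| * Real.exp (-t ^ 2) = 1 := by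
  have h := integral_comp_abs (f := fun t : ℝ => t * Real.exp (-t ^ 2))
  have h1 := integral_pow_mul_exp_neg_sq 1
  simp only [sq_abs] at h
  simp only [pow_one] at h1
  rw [h, h1]
  norm_num

theorem integral_sq_mul_exp_neg_sq :
    ∫ t : ℝ, t * t * Real.exp (-t ^ 2) = √Real.pi / 2 := by
  have h := integral_comp_abs (f := fun t : ℝ => t ^ 2 * Real.exp (-t ^ 2))
  have h1 := integral_pow_mul_exp_neg_sq 2
  simp only [sq_abs] at h
  simp only [← sq]
  rw [h, h1, show (((2 : ℕ) : ℝ) + 1) / 2 = 1 / 2 + 1 by norm_num,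
    Real.Gamma_add_one (by norm_num), Real.Gamma_one_half_eq]
  ring

/-- Integration in polar coordinates against the Gaussian weight `exp (-‖x‖²)`: for a positively
homogeneous function, the radial part is a value of the Gamma function. -/
theorem integral_homogeneous_mul_exp {m : ℕ} (hm : 1 ≤ m) (p : ℕ)
    (F : EuclideanSpace ℝ (Fin m) → ℝ)
    (hF : ∀ (r : ℝ) (x : EuclideanSpace ℝ (Fin m)), 0 < r → F (r • x) = r ^ p * F x) :
    ∫ x, F x * Real.exp (-‖x‖ ^ 2) =
      (∫ s : Metric.sphere (0 : EuclideanSpace ℝ (Fin m)) 1, F s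
        ∂(volume : Measure (EuclideanSpace ℝ (Fin m))).toSphere) *
      (Real.Gamma (((m : ℝ) + p) / 2) / 2) := by
  have : Nonempty (Fin m) := ⟨⟨0, hm⟩⟩
  set μ : Measure (EuclideanSpace ℝ (Fin m)) := volume
  have hdim : Module.finrank ℝ (EuclideanSpace ℝ (Fin m)) = m := by simp
  calc ∫ x, F x * Real.exp (-‖x‖ ^ 2) ∂μ
      = ∫ x : ({(0)}ᶜ : Set (EuclideanSpace ℝ (Fin m))), F x * Real.exp (-‖x.1‖ ^ 2)
          ∂(μ.comap (↑)) := by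
        rw [integral_subtype_comap (measurableSet_singleton _).compl
          fun x : EuclideanSpace ℝ (Fin m) => F x * Real.exp (-‖x‖ ^ 2), restrict_compl_singleton]
    _ = ∫ z, F z.1 * (z.2.1 ^ p * Real.exp (-z.2.1 ^ 2))
          ∂μ.toSphere.prod (.volumeIoiPow (m - 1)) := by
        have h := μ.measurePreserving_homeomorphUnitSphereProd.integral_comp
          (Homeomorph.measurableEmbedding _)
          (fun z => F z.1 * (z.2.1 ^ p * Real.exp (-z.2.1 ^ 2)))
        rw [hdim] at h
        rw [← h]
        refine integral_congr_ae (.of_forall fun x => ?_)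
        have hx : 0 < ‖x.1‖ := norm_pos_iff.2 x.2
        simp only [homeomorphUnitSphereProd_apply_fst_coe, homeomorphUnitSphereProd_apply_snd_coe]
        rw [hF _ _ (inv_pos.2 hx), inv_pow]
        field_simp
    _ = (∫ s, F s ∂μ.toSphere) *
          ∫ r : Set.Ioi (0 : ℝ), r.1 ^ p * Real.exp (-r.1 ^ 2) ∂.volumeIoiPow (m - 1) :=
        integral_prod_mul (fun s : Metric.sphere (0 : EuclideanSpace ℝ (Fin m)) 1 => F s)
          (fun r : Set.Ioi (0 : ℝ) => r.1 ^ p * Real.exp (-r.1 ^ 2))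
    _ = _ := by
        congr 1
        simp only [Measure.volumeIoiPow, ENNReal.ofReal]
        rw [integral_withDensity_eq_integral_smul,
          integral_subtype_comap measurableSet_Ioi fun r : ℝ =>
            Real.toNNReal (r ^ (m - 1)) • (r ^ p * Real.exp (-r ^ 2)),
          setIntegral_congr_fun measurableSet_Ioi
            (g := fun r : ℝ => r ^ (m - 1 + p) * Real.exp (-r ^ 2)) fun r hr => ?_,
          integral_pow_mul_exp_neg_sq]
        · congr 3
          push_cast [Nat.cast_sub hm]
          ring
        · simp only [NNReal.smul_def, smul_eq_mul]
          rw [Real.coe_toNNReal _ (pow_nonneg (le_of_lt hr) _), pow_add, mul_assoc]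
        · exact (measurable_subtype_coe.pow_const _).real_toNNReal

theorem integral_comp_coord_mul_exp {m : ℕ} (g : ℝ → ℝ) (i : Fin m) :
    ∫ x : EuclideanSpace ℝ (Fin m), g (x i) * Real.exp (-‖x‖ ^ 2) =
      (∫ t, g t * Real.exp (-t ^ 2)) * √Real.pi ^ (m - 1) := by
  have hg : ∫ t : ℝ, Real.exp (-t ^ 2) = √Real.pi := by
    simpa using integral_gaussian 1
  have h1 : ∀ x : EuclideanSpace ℝ (Fin m), g (x i) * Real.exp (-‖x‖ ^ 2) =
      ∏ j, Function.update (fun _ t => Real.exp (-t ^ 2)) i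
        (fun t => g t * Real.exp (-t ^ 2)) j (x.ofLp j) := fun x => by
    rw [EuclideanSpace.norm_sq_eq, ← Finset.sum_neg_distrib, Real.exp_sum,
      ← Finset.mul_prod_erase _ _ (Finset.mem_univ i),
      ← Finset.mul_prod_erase _ _ (Finset.mem_univ i), ← mul_assoc]
    congr 1
    · simp
    · refine Finset.prod_congr rfl fun j hj => ?_
      rw [Function.update_of_ne (Finset.ne_of_mem_erase hj)]
      simp
  simp only [h1]
  rw [(PiLp.volume_preserving_ofLp (Fin m)).integral_comp
    (MeasurableEquiv.toLp 2 (Fin m → ℝ)).symm.measurableEmbedding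
    (fun y : Fin m → ℝ => ∏ j, Function.update (fun _ t => Real.exp (-t ^ 2)) i
        (fun t => g t * Real.exp (-t ^ 2)) j (y j)),
    integral_fintype_prod_volume_eq_prod, ← Finset.mul_prod_erase _ _ (Finset.mem_univ i)]
  congr 1
  · simp
  · rw [Finset.prod_congr rfl (g := fun _ => √Real.pi) fun j hj => ?_]
    · simp [Finset.card_erase_of_mem]
    · rw [Function.update_of_ne (Finset.ne_of_mem_erase hj), hg]

/-- Rotation invariance: the reflection exchanging `u` with a coordinate vector reduces the
integral to a product of one-dimensional ones. -/
theorem integral_comp_inner_mul_exp {m : ℕ} (hm : 1 ≤ m) (g : ℝ → ℝ)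
    {u : EuclideanSpace ℝ (Fin m)} (hu : ‖u‖ = 1) :
    ∫ x : EuclideanSpace ℝ (Fin m), g ⟪u, x⟫ * Real.exp (-‖x‖ ^ 2) =
      (∫ t, g t * Real.exp (-t ^ 2)) * √Real.pi ^ (m - 1) := by
  let e : EuclideanSpace ℝ (Fin m) := EuclideanSpace.single ⟨0, hm⟩ 1
  have he : ‖e‖ = 1 := by simp [e]
  let R := (ℝ ∙ (u - e))ᗮ.reflection
  have hR : R u = e := Submodule.reflection_sub (hu.trans he.symm)
  rw [← integral_comp_coord_mul_exp g ⟨0, hm⟩,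
    ← R.measurePreserving.integral_comp R.toMeasurableEquiv.measurableEmbedding
      (fun x => g (x ⟨0, hm⟩) * Real.exp (-‖x‖ ^ 2))]
  refine integral_congr_ae (.of_forall fun x => ?_)
  have : (R x) ⟨0, hm⟩ = ⟪u, x⟫ := by
    rw [← R.inner_map_map u x, hR]
    simp [e, EuclideanSpace.inner_single_left]
  simp only [this, R.norm_map]

/-- The reflection that fixes the line through `u` and negates its orthogonal complement makes the
integrand odd. -/
theorem integral_comp_inner_mul_inner_of_orthogonal {m : ℕ} (g : ℝ → ℝ)
    {u w : EuclideanSpace ℝ (Fin m)} (huw : ⟪u, w⟫ = 0) :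
    ∫ x : EuclideanSpace ℝ (Fin m), g ⟪u, x⟫ * ⟪w, x⟫ * Real.exp (-‖x‖ ^ 2) = 0 := by
  let R := (ℝ ∙ u).reflection
  have hRu : R u = u :=
    Submodule.reflection_mem_subspace_eq_self (Submodule.mem_span_singleton_self u)
  have hRw : R w = -w := Submodule.reflection_mem_subspace_orthogonalComplement_eq_neg
    (Submodule.mem_orthogonal_singleton_iff_inner_right.2 huw)
  have h := R.measurePreserving.integral_comp R.toMeasurableEquiv.measurableEmbedding
    (fun x => g ⟪u, x⟫ * ⟪w, x⟫ * Real.exp (-‖x‖ ^ 2))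
  have h2 : ∀ x, g ⟪u, R x⟫ * ⟪w, R x⟫ * Real.exp (-‖R x‖ ^ 2) =
      -(g ⟪u, x⟫ * ⟪w, x⟫ * Real.exp (-‖x‖ ^ 2)) := fun x => by
    have e1 : ⟪u, R x⟫ = ⟪u, x⟫ := by
      rw [← R.inner_map_map u x, hRu]
    have e2 : ⟪w, R x⟫ = -⟪w, x⟫ := by
      rw [← R.inner_map_map w x, hRw, inner_neg_left, neg_neg]
    rw [e1, e2, R.norm_map]
    ring
  simp only [h2, integral_neg] at h
  linarith

theorem measurable_sgn : Measurable sgn :=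
  Measurable.ite measurableSet_Ici measurable_const measurable_const

theorem sgn_mul_self (t : ℝ) : sgn t * t = |t| := by
  unfold sgn
  split_ifs with h
  · rw [abs_of_nonneg h, one_mul]
  · rw [abs_of_neg (not_le.1 h), neg_one_mul]

theorem abs_sgn (t : ℝ) : |sgn t| = 1 := by
  unfold sgn
  split_ifs <;> simp

theorem sgn_mul_of_pos {r : ℝ} (hr : 0 < r) (t : ℝ) : sgn (r * t) = sgn t := by
  unfold sgn
  simp only [mul_nonneg_iff_of_pos_left hr]

theorem sphere_integral_of_orthogonal {m : ℕ} (hm : 1 ≤ m) {h : ℝ → ℝ} {q : ℕ}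
    (hh : ∀ r t : ℝ, 0 < r → h (r * t) = r ^ q * h t)
    {u w : EuclideanSpace ℝ (Fin m)} (huw : ⟪u, w⟫ = 0) :
    ∫ s : Metric.sphere (0 : EuclideanSpace ℝ (Fin m)) 1,
        h ⟪u, s⟫ * ⟪w, (s : EuclideanSpace ℝ (Fin m))⟫
        ∂(volume : Measure (EuclideanSpace ℝ (Fin m))).toSphere = 0 := by
  have h1 := integral_homogeneous_mul_exp hm (q + 1) (fun x => h ⟪u, x⟫ * ⟪w, x⟫) fun r x hr => by
    simp only [inner_smul_right, hh _ _ hr]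
    ring
  rw [integral_comp_inner_mul_inner_of_orthogonal h huw] at h1
  have hm' : (0 : ℝ) < m := by exact_mod_cast hm
  have hG := Real.Gamma_pos_of_pos (by positivity : (0 : ℝ) < ((m : ℝ) + (q + 1 : ℕ)) / 2)
  exact (mul_eq_zero.1 h1.symm).resolve_right (by positivity)

/-- A function of the coordinate along `u` only correlates with the component of a linear form
along `u`. -/
theorem sphere_integral_comp_inner_mul_inner {m : ℕ} (hm : 1 ≤ m) {h : ℝ → ℝ} {q : ℕ}
    (hh : ∀ r t : ℝ, 0 < r → h (r * t) = r ^ q * h t) (hmeas : Measurable h)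
    (hb : ∀ t, |t| ≤ 1 → |h t| ≤ 1) {u : EuclideanSpace ℝ (Fin m)} (hu : ‖u‖ = 1)
    (v : EuclideanSpace ℝ (Fin m)) :
    (∫ s : Metric.sphere (0 : EuclideanSpace ℝ (Fin m)) 1,
        h ⟪u, s⟫ * ⟪v, (s : EuclideanSpace ℝ (Fin m))⟫
        ∂(volume : Measure (EuclideanSpace ℝ (Fin m))).toSphere) *
      (Real.Gamma (((m : ℝ) + q + 1) / 2) / 2) =
      ⟪u, v⟫ * ((∫ t, h t * t * Real.exp (-t ^ 2)) * √Real.pi ^ (m - 1)) := by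
  set w := v - ⟪u, v⟫ • u with hw
  have huw : ⟪u, w⟫ = 0 := by
    rw [hw, inner_sub_right, inner_smul_right, real_inner_self_eq_norm_sq, hu]
    ring
  have hle : ∀ (y : EuclideanSpace ℝ (Fin m))
      (s : Metric.sphere (0 : EuclideanSpace ℝ (Fin m)) 1), |⟪y, s⟫| ≤ ‖y‖ := fun y s => by
    have := abs_real_inner_le_norm y s
    rwa [norm_eq_of_mem_sphere, mul_one] at this
  have hint : ∀ y : EuclideanSpace ℝ (Fin m),
      Integrable (fun s : Metric.sphere (0 : EuclideanSpace ℝ (Fin m)) 1 =>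
        h ⟪u, s⟫ * ⟪y, (s : EuclideanSpace ℝ (Fin m))⟫)
        (volume : Measure (EuclideanSpace ℝ (Fin m))).toSphere := fun y => by
    refine Integrable.of_bound (C := ‖y‖) ?_ (.of_forall fun s => ?_)
    · refine Measurable.aestronglyMeasurable ?_
      refine (hmeas.comp ?_).mul ?_ <;> fun_prop
    · rw [Real.norm_eq_abs, abs_mul]
      calc _ ≤ 1 * ‖y‖ := by
            gcongr
            · exact hb _ ((hle u s).trans hu.le)
            · exact hle y s
        _ = ‖y‖ := one_mul _
  have hv : ∀ s : Metric.sphere (0 : EuclideanSpace ℝ (Fin m)) 1,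
      h ⟪u, s⟫ * ⟪v, (s : EuclideanSpace ℝ (Fin m))⟫ =
      ⟪u, v⟫ * (h ⟪u, s⟫ * ⟪u, (s : EuclideanSpace ℝ (Fin m))⟫) +
        h ⟪u, s⟫ * ⟪w, (s : EuclideanSpace ℝ (Fin m))⟫ := fun s => by
    rw [hw, inner_sub_left, real_inner_smul_left]
    ring
  simp only [hv]
  rw [integral_add ((hint u).const_mul _) (hint w), sphere_integral_of_orthogonal hm hh huw,
    integral_const_mul, add_zero]
  have h1 := integral_homogeneous_mul_exp hm (q + 1) (fun x => h ⟪u, x⟫ * ⟪u, x⟫) fun r x hr => by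
    simp only [inner_smul_right, hh _ _ hr]
    ring
  rw [integral_comp_inner_mul_exp hm (fun t => h t * t) hu] at h1
  push_cast at h1
  rw [h1, add_assoc]
  ring

theorem sphere_total_mass {m : ℕ} (hm : 1 ≤ m) :
    ((volume : Measure (EuclideanSpace ℝ (Fin m))).toSphere.real Set.univ) *
      (Real.Gamma ((m : ℝ) / 2) / 2) = √Real.pi ^ m := by
  have h := integral_homogeneous_mul_exp hm 0 (fun _ => 1) (by simp)
  have h2 := integral_comp_coord_mul_exp (fun _ => 1) (⟨0, hm⟩ : Fin m)
  have hg : ∫ t : ℝ, Real.exp (-t ^ 2) = √Real.pi := by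
    simpa using integral_gaussian 1
  simp only [integral_const, smul_eq_mul, mul_one, Nat.cast_zero, add_zero] at h
  rw [← h, h2]
  simp only [one_mul, hg]
  rw [mul_comm, pow_sub_one_mul (by omega)]

theorem integral_uniformSphere {m : ℕ}
    (F : Metric.sphere (0 : EuclideanSpace ℝ (Fin m)) 1 → ℝ) :
    ∫ s, F s ∂(uniformSphere m) =
      ((volume : Measure (EuclideanSpace ℝ (Fin m))).toSphere.real Set.univ)⁻¹ *
      ∫ s, F s ∂(volume : Measure (EuclideanSpace ℝ (Fin m))).toSphere := by
  rw [uniformSphere, integral_smul_measure, ENNReal.toReal_inv, smul_eq_mul, measureReal_def]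

instance isFiniteMeasure_uniformSphere (m : ℕ) : IsFiniteMeasure (uniformSphere m) := by
  unfold uniformSphere
  constructor
  rw [Measure.smul_apply, smul_eq_mul]
  exact (ENNReal.inv_mul_le_one _).trans_lt ENNReal.one_lt_top

/-- The first absolute moment `E |g₁|` of a uniformly distributed unit vector of `ℝ^m`. -/
noncomputable def absMoment (m : ℕ) : ℝ :=
  Real.Gamma ((m : ℝ) / 2) / (√Real.pi * Real.Gamma (((m : ℝ) + 1) / 2))

theorem ratio_eq_absMoment {m : ℕ} (hm : 1 ≤ m) : ratio m = m * absMoment m ^ 2 := by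
  have hm' : (0 : ℝ) < m := by exact_mod_cast hm
  have h1 := Real.Gamma_pos_of_pos (by positivity : (0 : ℝ) < ((m : ℝ) + 1) / 2)
  have h2 := Real.Gamma_pos_of_pos (by positivity : (0 : ℝ) < (m : ℝ) / 2)
  have hpi := Real.pi_pos
  rw [ratio, gammaConst, absMoment, div_pow, div_pow, mul_pow, Real.sq_sqrt hpi.le]
  field_simp

theorem integral_sgn_mul_inner {m : ℕ} (hm : 1 ≤ m) {u : EuclideanSpace ℝ (Fin m)}
    (hu : ‖u‖ = 1) (v : EuclideanSpace ℝ (Fin m)) :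
    ∫ s, sgn ⟪u, s⟫ * ⟪v, (s : EuclideanSpace ℝ (Fin m))⟫ ∂(uniformSphere m) =
      absMoment m * ⟪u, v⟫ := by
  have hm' : (0 : ℝ) < m := by exact_mod_cast hm
  have h1 := Real.Gamma_pos_of_pos (by positivity : (0 : ℝ) < ((m : ℝ) + 1) / 2)
  have h2 := Real.Gamma_pos_of_pos (by positivity : (0 : ℝ) < (m : ℝ) / 2)
  have hpi : 0 < √Real.pi := Real.sqrt_pos.2 Real.pi_pos
  have hs := sphere_integral_comp_inner_mul_inner hm (h := sgn) (q := 0)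
    (fun r t hr => by rw [sgn_mul_of_pos hr, pow_zero, one_mul]) measurable_sgn
    (fun t _ => (abs_sgn t).le) hu v
  have hZ := sphere_total_mass hm
  simp only [sgn_mul_self, integral_abs_mul_exp_neg_sq, Nat.cast_zero, add_zero, one_mul] at hs
  rw [integral_uniformSphere, absMoment, eq_div_of_mul_eq (by positivity) hs,
    eq_div_of_mul_eq (by positivity) hZ, ← pow_sub_one_mul (by omega : m ≠ 0)]
  field_simp

theorem integral_inner_uniformSphere {m : ℕ} (hm : 1 ≤ m) (v : EuclideanSpace ℝ (Fin m)) :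
    ∫ s, ⟪v, (s : EuclideanSpace ℝ (Fin m))⟫ ∂(uniformSphere m) = 0 := by
  have := sphere_integral_of_orthogonal hm (h := fun _ => 1) (q := 0) (by simp)
    (u := 0) (w := v) (by simp)
  simp only [one_mul] at this
  rw [integral_uniformSphere, this, mul_zero]

theorem integral_inner_mul_inner {m : ℕ} (hm : 1 ≤ m) (u v : EuclideanSpace ℝ (Fin m)) :
    ∫ s, ⟪u, (s : EuclideanSpace ℝ (Fin m))⟫ * ⟪v, (s : EuclideanSpace ℝ (Fin m))⟫
      ∂(uniformSphere m) = ⟪u, v⟫ / m := by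
  have hm' : (0 : ℝ) < m := by exact_mod_cast hm
  rcases eq_or_ne u 0 with rfl | hu0
  · simp
  have hn : 0 < ‖u‖ := norm_pos_iff.2 hu0
  have h2 := Real.Gamma_pos_of_pos (by positivity : (0 : ℝ) < (m : ℝ) / 2)
  have hpi : 0 < √Real.pi := Real.sqrt_pos.2 Real.pi_pos
  have hs := sphere_integral_comp_inner_mul_inner hm (h := fun t => t) (q := 1)
    (fun r t hr => by rw [pow_one]) measurable_id (fun t ht => ht)
    (u := ‖u‖⁻¹ • u) (by rw [norm_smul, norm_inv, norm_norm, inv_mul_cancel₀ hn.ne']) v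
  have hZ := sphere_total_mass hm
  rw [integral_sq_mul_exp_neg_sq, Nat.cast_one,
    show ((m : ℝ) + 1 + 1) / 2 = m / 2 + 1 by ring, Real.Gamma_add_one (by positivity)] at hs
  simp only [real_inner_smul_left, mul_assoc, integral_const_mul] at hs
  rw [integral_uniformSphere, eq_div_of_mul_eq (by positivity) hZ]
  have hs' := mul_left_cancel₀ (inv_ne_zero hn.ne') hs
  rw [eq_div_of_mul_eq (by positivity) hs', ← pow_sub_one_mul (by omega : m ≠ 0) √Real.pi]
  field_simp

/-! ### The constant `γ` -/

theorem gammaConst_pos {k : ℕ} (hk : 1 ≤ k) : 0 < gammaConst k := by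
  have hk' : (0 : ℝ) < k := by exact_mod_cast hk
  have h1 := Real.Gamma_pos_of_pos (by positivity : (0 : ℝ) < ((k : ℝ) + 1) / 2)
  have h2 := Real.Gamma_pos_of_pos (by positivity : (0 : ℝ) < (k : ℝ) / 2)
  unfold gammaConst
  positivity

/-- The Gamma quotients telescope: `Γ((k + 1) / 2) / Γ(k / 2) · Γ((k + 2) / 2) / Γ((k + 1) / 2)` is
`k / 2`. -/
theorem gammaConst_mul_succ {k : ℕ} (hk : 1 ≤ k) :
    gammaConst k * gammaConst (k + 1) = k / (k + 1) := by
  have hk' : (0 : ℝ) < k := by exact_mod_cast hk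
  have h1 := Real.Gamma_pos_of_pos (by positivity : (0 : ℝ) < ((k : ℝ) + 1) / 2)
  have h2 := Real.Gamma_pos_of_pos (by positivity : (0 : ℝ) < (k : ℝ) / 2)
  have h3 : Real.Gamma (((k : ℝ) + 1 + 1) / 2) = k / 2 * Real.Gamma (k / 2) := by
    rw [← Real.Gamma_add_one (by positivity)]
    congr 1
    ring
  unfold gammaConst
  push_cast
  rw [h3]
  field_simp

/-- Logarithmic convexity of `Γ` at the midpoint `(k + 1) / 2` of `k / 2` and `k / 2 + 1`. -/
theorem gammaConst_le_one {k : ℕ} (hk : 1 ≤ k) : gammaConst k ≤ 1 := by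
  have hk' : (0 : ℝ) < k := by exact_mod_cast hk
  have h2 := Real.Gamma_pos_of_pos (by positivity : (0 : ℝ) < (k : ℝ) / 2)
  have h := Real.Gamma_mul_add_mul_le_rpow_Gamma_mul_rpow_Gamma
    (by positivity : (0 : ℝ) < (k : ℝ) / 2) (by positivity : (0 : ℝ) < (k : ℝ) / 2 + 1)
    (by norm_num : (0 : ℝ) < 1 / 2) (by norm_num : (0 : ℝ) < 1 / 2) (by norm_num)
  rw [Real.Gamma_add_one (by positivity), ← Real.sqrt_eq_rpow, ← Real.sqrt_eq_rpow,
    ← Real.sqrt_mul h2.le,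
    show 1 / 2 * ((k : ℝ) / 2) + 1 / 2 * (k / 2 + 1) = (k + 1) / 2 by ring] at h
  have h1 := Real.Gamma_pos_of_pos (by positivity : (0 : ℝ) < ((k : ℝ) + 1) / 2)
  have h4 : Real.Gamma (((k : ℝ) + 1) / 2) ^ 2 ≤ k / 2 * Real.Gamma (k / 2) ^ 2 := by
    calc _ ≤ √(Real.Gamma (k / 2) * (k / 2 * Real.Gamma (k / 2))) ^ 2 := by gcongr
      _ = _ := by rw [Real.sq_sqrt (by positivity)]; ring
  unfold gammaConst
  rw [div_pow, div_mul_div_comm, div_le_one (by positivity)]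
  linarith

theorem le_gammaConst {k : ℕ} (hk : 1 ≤ k) : (k : ℝ) / (k + 1) ≤ gammaConst k := by
  rw [← gammaConst_mul_succ hk]
  exact mul_le_of_le_one_right (gammaConst_pos hk).le (gammaConst_le_one (by omega))

theorem gammaConst_add_two {k : ℕ} (hk : 1 ≤ k) :
    gammaConst (k + 2) = gammaConst k * (((k : ℝ) + 1) ^ 2 / (k * (k + 2))) := by
  have hk' : (0 : ℝ) < k := by exact_mod_cast hk
  have h1 := gammaConst_mul_succ hk
  have h2 := gammaConst_mul_succ (k := k + 1) (by omega)
  have hp := gammaConst_pos (k := k + 1) (by omega)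
  push_cast at h2
  rw [add_assoc, one_add_one_eq_two] at h2
  have h3 : gammaConst k = k / (k + 1) / gammaConst (k + 1) := by
    rw [← h1]; field_simp
  have h4 : gammaConst (k + 2) = ((k : ℝ) + 1) / (k + 1 + 1) / gammaConst (k + 1) := by
    rw [← h2]; field_simp
  rw [h3, h4]
  field_simp
  ring

/-- The quantity `γ(k)² (k + 1) / k` increases along steps of length two and tends to `1`, so it is
at most `1`. -/
theorem gammaConst_sq_le {k : ℕ} (hk : 1 ≤ k) : gammaConst k ^ 2 ≤ k / (k + 1) := by
  let a : ℕ → ℝ := fun j => gammaConst (k + 2 * j) ^ 2 * (((k + 2 * j : ℕ) : ℝ) + 1) /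
    ((k + 2 * j : ℕ) : ℝ)
  have hmono : Monotone a := by
    refine monotone_nat_of_le_succ fun j => ?_
    have hj : 1 ≤ k + 2 * j := by omega
    simp only [a, show k + 2 * (j + 1) = k + 2 * j + 2 by ring]
    generalize k + 2 * j = l at hj
    have hl : (0 : ℝ) < l := by exact_mod_cast hj
    have hg := gammaConst_pos hj
    rw [gammaConst_add_two hj]
    push_cast
    rw [div_le_div_iff₀ hl (by positivity)]
    have e : (gammaConst l * (((l : ℝ) + 1) ^ 2 / (l * (l + 2)))) ^ 2 * ((l : ℝ) + 2 + 1) * l =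
        gammaConst l ^ 2 * (((l : ℝ) + 1) ^ 4 * (l + 3) * l / (l * (l + 2)) ^ 2) := by
      field_simp
      ring
    rw [e, mul_assoc]
    refine mul_le_mul_of_nonneg_left ?_ (by positivity)
    rw [le_div_iff₀ (by positivity)]
    -- After cancelling `l (l + 1)`, the claim is `l (l + 2) ^ 3 ≤ (l + 1) ^ 3 (l + 3)`, whose
    -- two sides differ by `2 l + 3`.
    have : 0 ≤ (l : ℝ) * (l + 1) * (2 * l + 3) := by positivity
    nlinarith [this]
  have hbound : ∀ j, a j ≤ 1 + 1 / ((j : ℝ) + 1) := fun j => by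
    have hj : 1 ≤ k + 2 * j := by omega
    have hl : (0 : ℝ) < ((k + 2 * j : ℕ) : ℝ) := by exact_mod_cast hj
    have hg := gammaConst_pos hj
    have hle : (j : ℝ) + 1 ≤ ((k + 2 * j : ℕ) : ℝ) := by
      have : j + 1 ≤ k + 2 * j := by omega
      exact_mod_cast this
    calc a j ≤ 1 * (((k + 2 * j : ℕ) : ℝ) + 1) / ((k + 2 * j : ℕ) : ℝ) := by
          simp only [a]
          gcongr
          exact pow_le_one₀ hg.le (gammaConst_le_one hj)
      _ = 1 + 1 / ((k + 2 * j : ℕ) : ℝ) := by field_simp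
      _ ≤ _ := by gcongr
  have hlim : Filter.Tendsto (fun j : ℕ => 1 + 1 / ((j : ℝ) + 1)) Filter.atTop (nhds (1 + 0)) :=
    tendsto_const_nhds.add tendsto_one_div_add_atTop_nhds_zero_nat
  have h0 : a 0 ≤ 1 + 0 :=
    ge_of_tendsto' hlim fun j => (hmono (Nat.zero_le j)).trans (hbound j)
  have hk' : (0 : ℝ) < k := by exact_mod_cast hk
  simp only [a, mul_zero, add_zero] at h0
  rw [div_le_one hk'] at h0
  rwa [le_div_iff₀ (by positivity)]

theorem gammaConst_le_succ {k : ℕ} (hk : 1 ≤ k) : gammaConst k ≤ gammaConst (k + 1) := by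
  have h := gammaConst_sq_le hk
  rw [← gammaConst_mul_succ hk, sq] at h
  exact le_of_mul_le_mul_left h (gammaConst_pos hk)

theorem gammaConst_mono {k l : ℕ} (hk : 1 ≤ k) (hkl : k ≤ l) : gammaConst k ≤ gammaConst l := by
  induction l, hkl using Nat.le_induction with
  | base => exact le_rfl
  | succ l hl ih => exact ih.trans (gammaConst_le_succ (hk.trans hl))

theorem ratio_pos {k : ℕ} (hk : 1 ≤ k) : 0 < ratio k :=
  div_pos two_pos (mul_pos Real.pi_pos (gammaConst_pos hk))

theorem ratio_anti {k l : ℕ} (hk : 1 ≤ k) (hkl : k ≤ l) : ratio l ≤ ratio k := by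
  have := gammaConst_pos hk
  have := Real.pi_pos
  unfold ratio
  gcongr
  exact gammaConst_mono hk hkl

theorem ratio_eq_mul_inv (k : ℕ) : ratio k = 2 / Real.pi * (gammaConst k)⁻¹ := by
  rw [ratio, ← div_div, div_eq_mul_inv (2 / Real.pi)]

theorem ratio_le {k : ℕ} (hk : 1 ≤ k) : ratio k ≤ 2 / Real.pi + 2 / Real.pi / k := by
  have hk' : (0 : ℝ) < k := by exact_mod_cast hk
  have hpi := Real.pi_pos
  have h : (gammaConst k)⁻¹ ≤ 1 + 1 / k := by
    refine (inv_anti₀ (by positivity) (le_gammaConst hk)).trans_eq ?_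
    field_simp
  calc ratio k = 2 / Real.pi * (gammaConst k)⁻¹ := ratio_eq_mul_inv k
    _ ≤ 2 / Real.pi * (1 + 1 / k) := by gcongr
    _ = _ := by ring

theorem le_ratio {k : ℕ} (hk : 1 ≤ k) :
    2 / Real.pi + 2 / Real.pi / 3 / k ≤ ratio k := by
  have hk' : (1 : ℝ) ≤ k := by exact_mod_cast hk
  have hpi := Real.pi_pos
  have hg := gammaConst_pos hk
  have h : 1 + 1 / 3 / (k : ℝ) ≤ (gammaConst k)⁻¹ := by
    refine (pow_le_pow_iff_left₀ (by positivity) (by positivity) two_ne_zero).1 ?_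
    rw [inv_pow]
    refine le_trans ?_ (inv_anti₀ (by positivity) (gammaConst_sq_le hk))
    rw [inv_div]
    have hinv : (0 : ℝ) < 1 / k := by positivity
    have hinv1 : 1 / (k : ℝ) ≤ 1 := (div_le_one (by positivity)).2 hk'
    have e1 : 1 / 3 / (k : ℝ) = 1 / 3 * (1 / k) := by ring
    have e2 : ((k : ℝ) + 1) / k = 1 + 1 / k := by field_simp
    rw [e1, e2]
    nlinarith
  calc _ = 2 / Real.pi * (1 + 1 / 3 / k) := by ring
    _ ≤ 2 / Real.pi * (gammaConst k)⁻¹ := by gcongr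
    _ = ratio k := (ratio_eq_mul_inv k).symm

/-! ### Randomized rounding -/

/-- The matrix whose rows are the rows of `X` scaled to Euclidean norm `1`; a zero row stays
zero. -/
noncomputable def normalizedRows {n m : ℕ} (X : Matrix (Fin n) (Fin m) ℝ) :
    Matrix (Fin n) (Fin m) ℝ :=
  Matrix.of fun i j => (√((X * Xᵀ) i i))⁻¹ * X i j

theorem mul_transpose_apply_eq_inner {n m : ℕ} (X Z : Matrix (Fin n) (Fin m) ℝ) (i j : Fin n) :
    (X * Zᵀ) i j = ⟪WithLp.toLp 2 (X i), WithLp.toLp 2 (Z j)⟫ := by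
  simp [Matrix.mul_apply, PiLp.inner_apply, mul_comm]

theorem rounded_eq {n m : ℕ} (X : Matrix (Fin n) (Fin m) ℝ) (g : EuclideanSpace ℝ (Fin m))
    (i : Fin n) : rounded X g i = sgn ⟪WithLp.toLp 2 (X i), g⟫ := by
  simp [rounded, Matrix.mulVec, dotProduct, PiLp.inner_apply, mul_comm]

theorem integral_rounded_mul_inner {n m : ℕ} (hm : 1 ≤ m) (X : Matrix (Fin n) (Fin m) ℝ)
    (i j : Fin n) :
    ∫ s, rounded X s i * ⟪WithLp.toLp 2 (X j), (s : EuclideanSpace ℝ (Fin m))⟫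
      ∂(uniformSphere m) = absMoment m * (normalizedRows X * Xᵀ) i j := by
  simp only [rounded_eq]
  have hnorm : √((X * Xᵀ) i i) = ‖WithLp.toLp 2 (X i)‖ := by
    rw [mul_transpose_apply_eq_inner, real_inner_self_eq_norm_sq, Real.sqrt_sq (norm_nonneg _)]
  have hrow : WithLp.toLp 2 (normalizedRows X i) =
      ‖WithLp.toLp 2 (X i)‖⁻¹ • (WithLp.toLp 2 (X i) : EuclideanSpace ℝ (Fin m)) := by
    ext l
    simp [normalizedRows, hnorm]
  rw [mul_transpose_apply_eq_inner, hrow]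
  rcases eq_or_ne (WithLp.toLp 2 (X i) : EuclideanSpace ℝ (Fin m)) 0 with h0 | h0
  · -- A zero row is always rounded to `1`, which is uncorrelated with every linear form.
    simp only [h0, inner_zero_left, smul_zero, mul_zero, sgn, le_refl, if_true, one_mul]
    exact integral_inner_uniformSphere hm _
  · have hn := norm_pos_iff.2 h0
    rw [← integral_sgn_mul_inner hm
      (by rw [norm_smul, norm_inv, norm_norm, inv_mul_cancel₀ hn.ne'])]
    simp only [real_inner_smul_left, sgn_mul_of_pos (inv_pos.2 hn)]

theorem sdp_mul_transpose {n m : ℕ} (A : Matrix (Fin n) (Fin n) ℝ)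
    (hA : A.IsHermitian) (X Z : Matrix (Fin n) (Fin m) ℝ) :
    sdp A (X * Zᵀ) = ∑ i, ∑ j, A i j * (X * Zᵀ) i j := by
  rw [sdp, trace, Finset.sum_comm]
  refine Finset.sum_congr rfl fun i _ => ?_
  rw [diag_apply, Matrix.mul_apply]
  refine Finset.sum_congr rfl fun j _ => ?_
  have : A i j = A j i := by simpa using (hA.apply i j).symm
  rw [this]

/-- The expectation of the nonnegative quantity `iqp A (sgn (X g) - c • X g)`, expanded. -/
theorem le_expectedValue {n m : ℕ} (hm : 1 ≤ m) {A : Matrix (Fin n) (Fin n) ℝ}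
    (hA : A.PosSemidef) (X : Matrix (Fin n) (Fin m) ℝ) (c : ℝ) :
    2 * c * absMoment m * sdp A (normalizedRows X * Xᵀ) - c ^ 2 / m * sdp A (X * Xᵀ) ≤
      expectedValue A X := by
  let h : Fin n → Metric.sphere (0 : EuclideanSpace ℝ (Fin m)) 1 → ℝ := fun i s => rounded X s i
  let l : Fin n → Metric.sphere (0 : EuclideanSpace ℝ (Fin m)) 1 → ℝ := fun i s =>
    ⟪WithLp.toLp 2 (X i), (s : EuclideanSpace ℝ (Fin m))⟫
  have hlm : ∀ i, Measurable (l i) := fun i => by fun_prop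
  have hhm : ∀ i, Measurable (h i) := fun i => by
    simp only [h, rounded_eq]
    exact measurable_sgn.comp (hlm i)
  have hlb : ∀ i s, |l i s| ≤ ‖(WithLp.toLp 2 (X i) : EuclideanSpace ℝ (Fin m))‖ := fun i s => by
    have := abs_real_inner_le_norm (WithLp.toLp 2 (X i)) (s : EuclideanSpace ℝ (Fin m))
    rwa [norm_eq_of_mem_sphere, mul_one] at this
  have hhb : ∀ i s, |h i s| ≤ 1 := fun i s => by
    simp only [h, rounded_eq]
    exact (abs_sgn _).le
  have hprod : ∀ {f g : Metric.sphere (0 : EuclideanSpace ℝ (Fin m)) 1 → ℝ} {a b : ℝ},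
      Measurable f → Measurable g → (∀ s, |f s| ≤ a) → (∀ s, |g s| ≤ b) →
      Integrable (fun s => f s * g s) (uniformSphere m) := fun {f g a b} hf hg ha hb => by
    refine Integrable.of_bound (C := a * b) (hf.mul hg).aestronglyMeasurable (.of_forall fun s => ?_)
    rw [Real.norm_eq_abs, abs_mul]
    exact mul_le_mul (ha s) (hb s) (abs_nonneg _) ((abs_nonneg _).trans (ha s))
  have hhh : ∀ i j, Integrable (fun s => h i s * h j s) (uniformSphere m) := fun i j =>
    hprod (hhm i) (hhm j) (hhb i) (hhb j)
  have hhl : ∀ i j, Integrable (fun s => h i s * l j s) (uniformSphere m) := fun i j =>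
    hprod (hhm i) (hlm j) (hhb i) (hlb j)
  have hll : ∀ i j, Integrable (fun s => l i s * l j s) (uniformSphere m) := fun i j =>
    hprod (hlm i) (hlm j) (hlb i) (hlb j)
  have hsum : ∀ {F : Fin n → Fin n → Metric.sphere (0 : EuclideanSpace ℝ (Fin m)) 1 → ℝ},
      (∀ i j, Integrable (F i j) (uniformSphere m)) →
      Integrable (fun s => ∑ i, ∑ j, A i j * F i j s) (uniformSphere m) ∧
      ∫ s, ∑ i, ∑ j, A i j * F i j s ∂(uniformSphere m) =
        ∑ i, ∑ j, A i j * ∫ s, F i j s ∂(uniformSphere m) := fun {F} hF => by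
    have h1 : ∀ i, Integrable (fun s => ∑ j, A i j * F i j s) (uniformSphere m) := fun i =>
      integrable_finsetSum _ fun j _ => (hF i j).const_mul _
    refine ⟨integrable_finsetSum _ fun i _ => h1 i, ?_⟩
    rw [integral_finsetSum _ fun i _ => h1 i]
    refine Finset.sum_congr rfl fun i _ => ?_
    rw [integral_finsetSum _ fun j _ => (hF i j).const_mul _]
    simp only [integral_const_mul]
  have hE : expectedValue A X =
      ∫ s, ∑ i, ∑ j, A i j * (h i s * h j s) ∂(uniformSphere m) := by
    refine integral_congr_ae (.of_forall fun s => ?_)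
    simp only [iqp, dotProduct, Matrix.mulVec, Finset.mul_sum, h]
    refine Finset.sum_congr rfl fun i _ => Finset.sum_congr rfl fun j _ => ?_
    ring
  have hHL : ∫ s, ∑ i, ∑ j, A i j * (h i s * l j s) ∂(uniformSphere m) =
      absMoment m * sdp A (normalizedRows X * Xᵀ) := by
    rw [(hsum hhl).2, sdp_mul_transpose A hA.1, Finset.mul_sum]
    refine Finset.sum_congr rfl fun i _ => ?_
    rw [Finset.mul_sum]
    refine Finset.sum_congr rfl fun j _ => ?_
    rw [integral_rounded_mul_inner hm X i j]
    ring
  have hLL : ∫ s, ∑ i, ∑ j, A i j * (l i s * l j s) ∂(uniformSphere m) =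
      sdp A (X * Xᵀ) / m := by
    rw [(hsum hll).2, sdp_mul_transpose A hA.1, Finset.sum_div]
    refine Finset.sum_congr rfl fun i _ => ?_
    rw [Finset.sum_div]
    refine Finset.sum_congr rfl fun j _ => ?_
    rw [integral_inner_mul_inner hm, mul_transpose_apply_eq_inner]
    ring
  have hpt : ∀ s, 2 * c * ∑ i, ∑ j, A i j * (h i s * l j s) -
      c ^ 2 * ∑ i, ∑ j, A i j * (l i s * l j s) ≤ ∑ i, ∑ j, A i j * (h i s * h j s) := fun s => by
    have h0 := hA.dotProduct_mulVec_nonneg fun i => h i s - c * l i s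
    have hsymm : ∑ i, ∑ j, A i j * (l i s * h j s) = ∑ i, ∑ j, A i j * (h i s * l j s) := by
      rw [Finset.sum_comm]
      refine Finset.sum_congr rfl fun i _ => Finset.sum_congr rfl fun j _ => ?_
      have : A i j = A j i := by simpa using (hA.1.apply i j).symm
      rw [this]
      ring
    have hexp : (star fun i => h i s - c * l i s) ⬝ᵥ (A *ᵥ fun i => h i s - c * l i s) =
        ∑ i, ∑ j, A i j * (h i s * h j s) - c * ∑ i, ∑ j, A i j * (h i s * l j s) -
        c * ∑ i, ∑ j, A i j * (l i s * h j s) + c ^ 2 * ∑ i, ∑ j, A i j * (l i s * l j s) := by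
      simp only [dotProduct, Matrix.mulVec, Finset.mul_sum, Pi.star_apply, star_trivial,
        ← Finset.sum_sub_distrib, ← Finset.sum_add_distrib]
      refine Finset.sum_congr rfl fun i _ => Finset.sum_congr rfl fun j _ => ?_
      ring
    rw [hexp, hsymm] at h0
    linarith
  have hmono := integral_mono
    (((hsum hhl).1.const_mul (2 * c)).sub ((hsum hll).1.const_mul (c ^ 2))) (hsum hhh).1 hpt
  rw [← hE] at hmono
  refine le_trans (le_of_eq ?_) hmono
  simp only [Pi.sub_apply]
  rw [integral_sub ((hsum hhl).1.const_mul (2 * c)) ((hsum hll).1.const_mul (c ^ 2)),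
    integral_const_mul, integral_const_mul, hHL, hLL]
  ring

/-- First-order optimality: moving the rows of a maximizer along the direction that lengthens them
to unit vectors, both forwards and backwards, stays weakly feasible, and the objective is a convex
quadratic along this line, so it is constant. -/
theorem sdp_normalizedRows {n m : ℕ} {A : Matrix (Fin n) (Fin n) ℝ} (hA : A.PosSemidef)
    {X : Matrix (Fin n) (Fin m) ℝ} (hX : ∀ i, (X * Xᵀ) i i ≤ 1)
    (hmax : ∀ T, WeaklyFeasible T → sdp A T ≤ sdp A (X * Xᵀ)) :
    sdp A (normalizedRows X * Xᵀ) = sdp A (X * Xᵀ) := by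
  set W := normalizedRows X - X with hW
  have hfeas : ∀ t : ℝ, t = 1 ∨ t = -1 → WeaklyFeasible ((X + t • W) * (X + t • W)ᵀ) := by
    refine fun t ht => ⟨posSemidef_mul_transpose _, fun i => ?_⟩
    have hx0 : 0 ≤ (X * Xᵀ) i i := (posSemidef_mul_transpose X).diag_nonneg
    have hx1 := hX i
    have hrow : ((X + t • W) * (X + t • W)ᵀ) i i =
        ((1 - t) + t * (√((X * Xᵀ) i i))⁻¹) ^ 2 * (X * Xᵀ) i i := by
      have hentry : ∀ l, (X + t • W) i l = ((1 - t) + t * (√((X * Xᵀ) i i))⁻¹) * X i l :=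
        fun l => by
          simp only [hW, Matrix.add_apply, Matrix.smul_apply, Matrix.sub_apply, smul_eq_mul,
            normalizedRows, Matrix.of_apply]
          ring
      generalize (1 - t) + t * (√((X * Xᵀ) i i))⁻¹ = a at hentry
      rw [Matrix.mul_apply, Matrix.mul_apply, Finset.mul_sum]
      refine Finset.sum_congr rfl fun l _ => ?_
      rw [Matrix.transpose_apply, Matrix.transpose_apply, hentry]
      ring
    rw [hrow]
    generalize (X * Xᵀ) i i = x at hx0 hx1
    obtain ⟨d, hd0, rfl⟩ : ∃ d : ℝ, 0 ≤ d ∧ x = d ^ 2 :=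
      ⟨√x, Real.sqrt_nonneg x, (Real.sq_sqrt hx0).symm⟩
    rw [Real.sqrt_sq hd0, ← mul_pow]
    rcases hd0.eq_or_lt with rfl | hd
    · simp
    · have hd1 : d ≤ 1 := by nlinarith
      rw [add_mul, mul_assoc, inv_mul_cancel₀ hd.ne', sq_le_one_iff_abs_le_one, abs_le]
      rcases ht with rfl | rfl <;> constructor <;> linarith
  have hquad : ∀ t : ℝ, sdp A ((X + t • W) * (X + t • W)ᵀ) =
      sdp A (X * Xᵀ) + 2 * t * sdp A (W * Xᵀ) + t ^ 2 * sdp A (W * Wᵀ) := fun t => by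
    have hsymm : sdp A (X * Wᵀ) = sdp A (W * Xᵀ) := by
      have hAt : Aᵀ = A := (conjTranspose_eq_transpose_of_trivial A).symm.trans hA.1.eq
      rw [sdp, ← trace_transpose, transpose_mul, transpose_mul, transpose_transpose, hAt,
        Matrix.trace_mul_comm, sdp]
    have hexp : sdp A ((X + t • W) * (X + t • W)ᵀ) = sdp A (X * Xᵀ) + t * sdp A (X * Wᵀ) +
        t * sdp A (W * Xᵀ) + t * (t * sdp A (W * Wᵀ)) := by
      simp only [sdp, transpose_add, transpose_smul, Matrix.add_mul, Matrix.mul_add,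
        Matrix.smul_mul, Matrix.mul_smul, trace_add, trace_smul, smul_eq_mul]
      ring
    rw [hexp, hsymm]
    ring
  have hWW : 0 ≤ sdp A (W * Wᵀ) := trace_mul_nonneg hA (posSemidef_mul_transpose W)
  have h1 := hmax _ (hfeas 1 (.inl rfl))
  have h2 := hmax _ (hfeas (-1) (.inr rfl))
  rw [hquad] at h1 h2
  have h3 : sdp A (W * Xᵀ) = sdp A (normalizedRows X * Xᵀ) - sdp A (X * Xᵀ) := by
    rw [hW, Matrix.sub_mul, sdp, Matrix.mul_sub, trace_sub, sdp, sdp]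
  linarith

theorem ratio_mul_le_expectedValue {n m : ℕ} (hm : 1 ≤ m) {A : Matrix (Fin n) (Fin n) ℝ}
    (hA : A.PosSemidef) {X : Matrix (Fin n) (Fin m) ℝ} (hX : ∀ i, (X * Xᵀ) i i ≤ 1)
    (hmax : ∀ T, WeaklyFeasible T → sdp A T ≤ sdp A (X * Xᵀ)) :
    ratio m * sdp A (X * Xᵀ) ≤ expectedValue A X := by
  -- The lower bound is a concave quadratic in `c`, and this value of `c` maximizes it.
  have h := le_expectedValue hm hA X (m * absMoment m)
  rw [sdp_normalizedRows hA hX hmax] at h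
  refine le_trans (le_of_eq ?_) h
  have hm' : (0 : ℝ) < m := by exact_mod_cast hm
  rw [ratio_eq_absMoment hm]
  field_simp
  ring

end PSDGrothendieck

theorem mainTheorem4 :
    -- the guarantee is `2/π + Θ(1/r)`, uniformly over all ranks `r ≥ 1`
    (∃ c C : ℝ, 0 < c ∧ 0 < C ∧ ∀ r : ℕ, 1 ≤ r →
      2 / Real.pi + c / (r : ℝ) ≤ PSDGrothendieck.ratio r ∧
      PSDGrothendieck.ratio r ≤ 2 / Real.pi + C / (r : ℝ)) ∧
    ∀ (n : ℕ) (A : Matrix (Fin n) (Fin n) ℝ), A.PosSemidef →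
      -- the modified system and a single reduction step
      (∀ (k : ℕ) (X : Matrix (Fin n) (Fin k) ℝ),
        A.rank < k → (∀ i, (X * X.transpose) i i ≤ 1) →
          (∃ Y, PSDGrothendieck.ModifiedSystem A X Y) ∧
          (∀ Y, PSDGrothendieck.ModifiedSystem A X Y →
            ∃ a : ℝ, 0 < a ∧ PSDGrothendieck.ModifiedSystem A X (a • Y) ∧
              PSDGrothendieck.MaxEigOne (a • Y)) ∧
          (∀ Y, PSDGrothendieck.ModifiedSystem A X Y → PSDGrothendieck.MaxEigOne Y →
            (PSDGrothendieck.update X Y).PosSemidef ∧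
            (PSDGrothendieck.update X Y).rank < k ∧
            PSDGrothendieck.sdp A (PSDGrothendieck.update X Y) =
              PSDGrothendieck.sdp A (X * X.transpose) ∧
            ∀ i, PSDGrothendieck.update X Y i i ∈ Set.Icc (0 : ℝ) 1) ∧
          (∃ Y, PSDGrothendieck.ModifiedSystem A X Y ∧ PSDGrothendieck.MaxEigOne Y ∧
            (PSDGrothendieck.update X Y).rank ≤ A.rank)) ∧
      -- the whole rank reduction
      (∀ S S' : Matrix (Fin n) (Fin n) ℝ, PSDGrothendieck.Step A S S' → S'.rank < S.rank) ∧
      (∀ S : Matrix (Fin n) (Fin n) ℝ, PSDGrothendieck.WeaklyFeasible S →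
        (∃ S', PSDGrothendieck.Output A S S') ∧
        ∀ S', PSDGrothendieck.Output A S S' →
          S'.PosSemidef ∧ S'.rank ≤ A.rank ∧
          PSDGrothendieck.sdp A S' = PSDGrothendieck.sdp A S ∧
          ∀ i, S' i i ∈ Set.Icc (0 : ℝ) 1) ∧
      -- the approximation ratio
      (A ≠ 0 → ∀ S S' : Matrix (Fin n) (Fin n) ℝ,
        PSDGrothendieck.Optimal A S → PSDGrothendieck.Output A S S' →
          (∀ T, PSDGrothendieck.WeaklyFeasible T →
            PSDGrothendieck.sdp A T ≤ PSDGrothendieck.sdp A S') ∧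
          0 < PSDGrothendieck.sdp A S ∧
          ∀ (m : ℕ) (X : Matrix (Fin n) (Fin m) ℝ), m ≤ A.rank → S' = X * X.transpose →
            PSDGrothendieck.ratio A.rank ≤
              PSDGrothendieck.expectedValue A X / PSDGrothendieck.sdp A S ∧
            ∀ x : Fin n → ℝ, (∀ i, x i = 1 ∨ x i = -1) →
              PSDGrothendieck.ratio A.rank * PSDGrothendieck.iqp A x ≤
                PSDGrothendieck.expectedValue A X) := by
  open PSDGrothendieck in
  refine ⟨⟨2 / Real.pi / 3, 2 / Real.pi, by positivity, by positivity,
    fun r hr => ⟨le_ratio hr, ratio_le hr⟩⟩, fun n A hA =>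
    ⟨fun k X hk hX => ⟨?_, fun Y hY => hY.exists_smul, fun Y hY h1 => ?_,
      exists_modifiedSystem_rank_le hA X hk⟩, fun S S' h => h.rank_lt,
      fun S hS => ⟨exists_output A S, fun S' h => ?_⟩, fun hA0 S S' hS h => ?_⟩⟩
  · obtain ⟨Y, hY, -⟩ := exists_modifiedSystem_rank_le hA X hk
    exact ⟨Y, hY⟩
  · have hpsd := update_posSemidef X hY.1 h1
    exact ⟨hpsd, rank_update_lt X hY.1 h1, sdp_update hY, fun i =>
      ⟨hpsd.diag_nonneg, (update_diag_le X hY.1 i).trans (hX i)⟩⟩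
  · obtain ⟨hS', heq⟩ := h.invariant hS
    exact ⟨hS'.1, h.rank_le hA hS, heq, fun i => ⟨hS'.1.diag_nonneg, hS'.2 i⟩⟩
  · obtain ⟨hS', heq⟩ := h.invariant ⟨hS.1.1, fun i => (hS.1.2 i).le⟩
    have hmax : ∀ T, WeaklyFeasible T → sdp A T ≤ sdp A S' := fun T hT =>
      (hS.sdp_le hA hT).trans_eq heq.symm
    have hpos := hS.sdp_pos hA hA0
    refine ⟨hmax, hpos, fun m X hm hX => ?_⟩
    subst hX
    have hm1 : 1 ≤ m := by
      -- With no columns the factorization would give objective value `0`.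
      rcases Nat.eq_zero_or_pos m with rfl | hm0
      · rw [← heq, sdp, Subsingleton.elim X 0] at hpos
        simp at hpos
      · exact hm0
    have hE : ratio A.rank * sdp A S ≤ expectedValue A X := by
      have h1 := ratio_mul_le_expectedValue hm1 hA hS'.2 hmax
      rw [heq] at h1
      exact (mul_le_mul_of_nonneg_right (ratio_anti hm1 hm) hpos.le).trans h1
    refine ⟨(le_div_iff₀ hpos).2 hE, fun x hx => ?_⟩
    exact (mul_le_mul_of_nonneg_left (hS.iqp_le hx) (ratio_pos (hm1.trans hm)).le).trans hE
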